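/- Let $p\ge 5$ be a prime. Let $B_n$ denote the Bernoulli numbers. For $1\le a\le p-1$ let $q_a=(a^{p-1}-1)/p$ be the Fermat quotient in base $a$, let $w_p=((p-1)!+1)/p$ be the Wilson quotient, let $(pB_{p-1})_1=(1+pB_{p-1})/p$ be the Agoh–Giuga quotient, and for $n\ge 1$ let $\mathfrak{B}_n=B_n/n$ be the $n$-th divided Bernoulli number. Put $$\mathcal{C}\mathfrak{B}(p-1)=\sum_{i=2}^{p-3}\mathfrak{B}_i\,\mathfrak{B}_{p-1-i}.$$ For a $p$-adic integer $x$ let $(x)_i\in\{0,\dots,p-1\}$ be the digits of its Hensel expansion $x=\sum_{i\ge 0}(x)_i\,p^i$ (the symbol $(pB_{p-1})_1$ defined above is not a digit of this kind). Two rational numbers are congruent modulo $p$ when both are $p$-adic integers and their difference lies in $p\mathbb{Z}_p$. Then $2p\,\mathfrak{B}_{2(p-1)}-p^2\mathfrak{B}_{p-1}^2$ is a $p$-adic integer, and $$\sum_{a=1}^{p-1}q_a^2\equiv -w_p^2-\mathcal{C}\mathfrak{B}(p-1)\pmod p,$$ $$\sum_{a=1}^{p-1}q_a^2\equiv -\big((pB_{p-1})_1-1\big)^2-\big(2p\,\mathfrak{B}_{2(p-1)}-p^2\mathfrak{B}_{p-1}^2\big)_2\pmod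 p,$$ $$\sum_{a=1}^{p-1}q_a^2\equiv \frac{pB_{2(p-1)}-2pB_{p-1}+p-1}{p^2}\pmod p.$$ -/

import Mathlib

/-- The Fermat quotient `q_a = (a^(p-1) - 1) / p` in base `a`. -/
def fermatQuot (p a : ℕ) : ℚ := ((a : ℚ) ^ (p - 1) - 1) / p

/-- The Wilson quotient `w_p = ((p-1)! + 1) / p`. -/
def wilsonQuot (p : ℕ) : ℚ := ((Nat.factorial (p - 1) : ℚ) + 1) / p

/-- The Agoh-Giuga quotient `(1 + p B_{p-1}) / p`. -/
def agohGiugaQuot (p : ℕ) : ℚ := (1 + p * bernoulli (p - 1)) / p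

/-- The divided Bernoulli number `B_n / n` (used for `n ≥ 1` only). -/
def divBernoulli (n : ℕ) : ℚ := bernoulli n / n

/-- The convolution of order `m` of divided Bernoulli numbers:
the sum of `(B_i / i) (B_{m-i} / (m-i))` over `2 ≤ i ≤ m - 2`. -/
def divBernoulliConv (m : ℕ) : ℚ :=
  ∑ i ∈ Finset.Icc 2 (m - 2), divBernoulli i * divBernoulli (m - i)

/-- `x ≡ y (mod p)` for rational numbers: both are `p`-adic integers, and their difference
is `p` times a `p`-adic integer. -/
def RatModEq (p : ℕ) [Fact p.Prime] (x y : ℚ) : Prop :=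
  ‖(x : ℚ_[p])‖ ≤ 1 ∧ ‖(y : ℚ_[p])‖ ≤ 1 ∧
    ∃ z : ℤ_[p], (x : ℚ_[p]) - (y : ℚ_[p]) = (p : ℚ_[p]) * (z : ℚ_[p])

/-- The digit `(x)_i` of `p^i` in the Hensel expansion `x = ∑ i, (x)_i p^i`, with digits in
`{0, …, p-1}`, of a `p`-adic integer `x`. Here `x.appr n` is the natural number smaller than `p^n`
that is congruent to `x` modulo `p^n`. -/
noncomputable def henselDigit {p : ℕ} [Fact p.Prime] (x : ℤ_[p]) (i : ℕ) : ℕ :=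
  x.appr (i + 1) / p ^ i

open Finset

/-! Write S_n for the power sums over 1, …, p-1 and M_n = ∑ q_a a^n for the moments of the Fermat
quotients. Since a^(p-1) = 1 + p q_a, one has p M_n = S_{n+p-1} - S_n, so congruences for power sums
modulo p^2 become congruences for moments modulo p.

Orthogonality of the powers modulo p (Parseval) gives ∑ q_a^2 ≡ -∑ M_i M_{p-1-i} over 0 ≤ i ≤ p-2.
Here M_0 ≡ M_{p-1} ≡ w_p (Lerch), odd moments vanish for 3 ≤ n ≤ p-2, and Kummer's congruence with
S_n ≡ p B_n (mod p^2) gives M_n ≡ -B_n/n. This is the first congruence.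

For the others, p^2 ∑ q_a^2 = S_{2(p-1)} - 2 S_{p-1} + (p-1) exactly, and both power sums equal p
B_n modulo p^3 (Faulhaber and von Staudt–Clausen). This is the third congruence. Substituting into
the combination of divided Bernoulli numbers shows that it is p^2 times a number congruent to -M_0^2
- ∑ q_a^2, while `agohGiugaQuot p - 1` reduces to M_0. -/

/-- The power sum `1 ^ n + ⋯ + (p - 1) ^ n`. -/
def unitPowSum (p n : ℕ) : ℤ := ∑ a ∈ Icc 1 (p - 1), (a : ℤ) ^ n

/-- The Fermat quotient as an integer. -/
def intFermatQuot (p a : ℕ) : ℤ := ((a : ℤ) ^ (p - 1) - 1) / p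

/-- The moment `∑ q_a a ^ n` of the Fermat quotients. -/
def fermatMoment (p n : ℕ) : ℤ := ∑ a ∈ Icc 1 (p - 1), intFermatQuot p a * (a : ℤ) ^ n

/-! ### Power sums and Fermat quotients over the integers -/

section Integers

variable {p : ℕ} [hp : Fact p.Prime]

theorem natCast_ne_zero_of_mem_Icc {a : ℕ} (ha : a ∈ Icc 1 (p - 1)) : (a : ZMod p) ≠ 0 := by
  rw [mem_Icc] at ha
  rw [Ne, ZMod.natCast_eq_zero_iff]
  intro h
  have := Nat.le_of_dvd (by omega) h
  have := hp.out.two_le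
  omega

theorem sum_Icc_pow_zmod (n : ℕ) :
    ∑ a ∈ Icc 1 (p - 1), (a : ZMod p) ^ n = if p - 1 ∣ n then -1 else 0 := by
  have hp2 := hp.out.two_le
  have hbij : ∑ a ∈ Icc 1 (p - 1), (a : ZMod p) ^ n = ∑ u : (ZMod p)ˣ, (u : ZMod p) ^ n :=
    Finset.sum_bij'
      (fun a ha ↦ Units.mk0 (a : ZMod p) (natCast_ne_zero_of_mem_Icc ha))
      (fun u _ ↦ (u : ZMod p).val)
      (fun _ _ ↦ Finset.mem_univ _)
      (fun u _ ↦ by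
        have h1 : (u : ZMod p).val ≠ 0 := by simp [ZMod.val_eq_zero]
        have h2 := ZMod.val_lt (u : ZMod p)
        rw [mem_Icc]; omega)
      (fun a ha ↦ by
        rw [mem_Icc] at ha
        simp [ZMod.val_cast_of_lt (show a < p by omega)])
      (fun u _ ↦ Units.ext (ZMod.natCast_zmod_val _))
      (fun _ _ ↦ rfl)
  rw [hbij, FiniteField.sum_pow_units, ZMod.card]

theorem cast_unitPowSum (n : ℕ) :
    (unitPowSum p n : ZMod p) = if p - 1 ∣ n then -1 else 0 := by
  rw [← sum_Icc_pow_zmod]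
  simp [unitPowSum]

theorem dvd_unitPowSum {n : ℕ} (h : ¬ p - 1 ∣ n) : (p : ℤ) ∣ unitPowSum p n := by
  rw [← ZMod.intCast_zmod_eq_zero_iff_dvd, cast_unitPowSum, if_neg h]

theorem intFermatQuot_spec {a : ℕ} (ha : a ∈ Icc 1 (p - 1)) :
    (a : ℤ) ^ (p - 1) = 1 + p * intFermatQuot p a := by
  have h : (p : ℤ) ∣ (a : ℤ) ^ (p - 1) - 1 := by
    rw [← ZMod.intCast_zmod_eq_zero_iff_dvd]
    push_cast
    rw [ZMod.pow_card_sub_one_eq_one (natCast_ne_zero_of_mem_Icc ha), sub_self]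
  rw [intFermatQuot, Int.mul_ediv_cancel' h]
  ring

theorem mul_fermatMoment (n : ℕ) :
    (p : ℤ) * fermatMoment p n = unitPowSum p (n + (p - 1)) - unitPowSum p n := by
  rw [fermatMoment, unitPowSum, unitPowSum, mul_sum, ← sum_sub_distrib]
  refine sum_congr rfl fun a ha ↦ ?_
  rw [pow_add, intFermatQuot_spec ha]
  ring

theorem sq_mul_sum_intFermatQuot_sq :
    (p : ℤ) ^ 2 * ∑ a ∈ Icc 1 (p - 1), intFermatQuot p a ^ 2 =
      unitPowSum p (2 * (p - 1)) - 2 * unitPowSum p (p - 1) + (p - 1) := by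
  have h1 : ((p : ℤ) - 1) = ∑ a ∈ Icc 1 (p - 1), (1 : ℤ) := by
    have := hp.out.two_le
    simp
    omega
  rw [unitPowSum, unitPowSum, h1, mul_sum, mul_sum, ← sum_sub_distrib, ← sum_add_distrib]
  refine sum_congr rfl fun a ha ↦ ?_
  rw [mul_comm 2, pow_mul, intFermatQuot_spec ha]
  ring

theorem unitPowSum_sub_one :
    unitPowSum p (p - 1) = p - 1 + p * fermatMoment p 0 := by
  have := mul_fermatMoment (p := p) 0
  have h1 : unitPowSum p 0 = p - 1 := by
    have := hp.out.two_le
    simp [unitPowSum]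
    omega
  rw [h1, zero_add] at this
  linarith

/-- The reflection a ↦ p - a gives 2 S_n ≡ n p S_{n-1} (mod p^2) for odd n, and p divides S_{n-1}.
-/
theorem sq_dvd_unitPowSum_of_odd (h2 : p ≠ 2) {n : ℕ} (hn : Odd n) (h : ¬ p - 1 ∣ n - 1) :
    (p : ℤ) ^ 2 ∣ unitPowSum p n := by
  have hp2 := hp.out.two_le
  have hrefl : unitPowSum p n = ∑ a ∈ Icc 1 (p - 1), ((p : ℤ) - a) ^ n := by
    refine sum_nbij' (fun a ↦ p - a) (fun a ↦ p - a) ?_ ?_ ?_ ?_ ?_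
    · intro a ha; rw [mem_Icc] at *; omega
    · intro a ha; rw [mem_Icc] at *; omega
    · intro a ha; rw [mem_Icc] at *; omega
    · intro a ha; rw [mem_Icc] at *; omega
    · intro a ha
      rw [mem_Icc] at ha
      rw [Nat.cast_sub (by omega)]
      ring
  have hterm : ∀ a : ℕ, ∃ k : ℤ, ((p : ℤ) - a) ^ n + a ^ n =
      n * p * a ^ (n - 1) + k * p ^ 2 := by
    intro a
    obtain ⟨k, hk⟩ := Polynomial.powAddExpansion (-(a : ℤ)) p n
    refine ⟨k, ?_⟩
    rw [sub_eq_neg_add, hk, hn.neg_pow, (show Even (n - 1) from hn.tsub_odd odd_one).neg_pow]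
    ring
  choose k hk using hterm
  have h2S : 2 * unitPowSum p n = n * p * unitPowSum p (n - 1) +
      (∑ a ∈ Icc 1 (p - 1), k a) * p ^ 2 := by
    rw [two_mul]
    nth_rw 1 [hrefl]
    rw [unitPowSum, unitPowSum, ← sum_add_distrib, mul_sum, sum_mul, ← sum_add_distrib]
    exact sum_congr rfl fun a _ ↦ hk a
  obtain ⟨c, hc⟩ := dvd_unitPowSum h
  have hcop : IsCoprime ((p : ℤ) ^ 2) 2 := by
    apply IsCoprime.pow_left
    exact_mod_cast Nat.isCoprime_iff_coprime.mpr ((Nat.coprime_primes hp.out Nat.prime_two).mpr h2)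
  refine hcop.dvd_of_dvd_mul_left ?_
  rw [h2S, hc]
  exact ⟨n * c + ∑ a ∈ Icc 1 (p - 1), k a, by ring⟩

/-! ### Voronoi's and Kummer's congruences -/

theorem sum_Icc_mul_mod {M : Type*} [AddCommMonoid M] (f : ℕ → M) {b : ℕ} (hb : ¬ p ∣ b) :
    ∑ a ∈ Icc 1 (p - 1), f (a * b % p) = ∑ a ∈ Icc 1 (p - 1), f a := by
  have hp2 := hp.out.two_le
  have hmaps : Set.MapsTo (fun a ↦ a * b % p) (Icc 1 (p - 1)) (Icc 1 (p - 1)) := by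
    intro a ha
    have ha' : ¬ p ∣ a := by
      rw [← ZMod.natCast_eq_zero_iff]
      exact natCast_ne_zero_of_mem_Icc ha
    have h1 : a * b % p ≠ 0 := fun h ↦
      (hp.out.dvd_mul.mp (Nat.dvd_of_mod_eq_zero h)).elim ha' hb
    have h2 := Nat.mod_lt (a * b) hp.out.pos
    simp only [coe_Icc, Set.mem_Icc]
    omega
  have hinj : Set.InjOn (fun a ↦ a * b % p) (Icc 1 (p - 1)) := by
    intro a ha c hc h
    simp only [coe_Icc, Set.mem_Icc] at ha hc
    have h' : a ≡ c [MOD p] := Nat.ModEq.cancel_right_of_coprime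
      ((Nat.Prime.coprime_iff_not_dvd hp.out).mpr hb) h
    exact Nat.ModEq.eq_of_lt_of_lt h' (by omega) (by omega)
  exact sum_nbij (fun a ↦ a * b % p) hmaps hinj
    (surjOn_of_injOn_of_card_le _ hmaps hinj le_rfl) fun _ _ ↦ rfl

/-- **Voronoi's congruence** for power sums. -/
theorem sq_dvd_voronoi {b : ℕ} (hb : ¬ p ∣ b) (m : ℕ) :
    (p : ℤ) ^ 2 ∣ ((b : ℤ) ^ m - 1) * unitPowSum p m -
      m * p * ∑ a ∈ Icc 1 (p - 1), ((a * b / p : ℕ) : ℤ) * ((a * b % p : ℕ) : ℤ) ^ (m - 1) := by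
  -- Write ab as remainder plus p times quotient and expand the m-th power to first order in p.
  have hterm : ∀ a : ℕ, ∃ k : ℤ, (b : ℤ) ^ m * (a : ℤ) ^ m = ((a * b % p : ℕ) : ℤ) ^ m +
      m * p * (((a * b / p : ℕ) : ℤ) * ((a * b % p : ℕ) : ℤ) ^ (m - 1)) + k * p ^ 2 := by
    intro a
    obtain ⟨k, hk⟩ := Polynomial.powAddExpansion ((a * b % p : ℕ) : ℤ)
      (p * (a * b / p : ℕ)) m
    refine ⟨k * ((a * b / p : ℕ) : ℤ) ^ 2, ?_⟩
    have h : ((a * b % p : ℕ) : ℤ) + (p * (a * b / p : ℕ)) = a * b := by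
      exact_mod_cast Nat.mod_add_div (a * b) p
    rw [h] at hk
    rw [← mul_pow, mul_comm (b : ℤ), hk]
    ring
  choose k hk using hterm
  refine ⟨∑ a ∈ Icc 1 (p - 1), k a, ?_⟩
  have hsum := sum_Icc_mul_mod (fun a ↦ (a : ℤ) ^ m) hb
  have : (b : ℤ) ^ m * unitPowSum p m = unitPowSum p m + m * p * ∑ a ∈ Icc 1 (p - 1),
      ((a * b / p : ℕ) : ℤ) * ((a * b % p : ℕ) : ℤ) ^ (m - 1) +
      (∑ a ∈ Icc 1 (p - 1), k a) * p ^ 2 := by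
    conv_rhs => rw [unitPowSum, ← hsum]
    rw [unitPowSum, mul_sum, mul_sum, sum_mul, ← sum_add_distrib, ← sum_add_distrib]
    exact sum_congr rfl fun a _ ↦ hk a
  linear_combination this

theorem exists_not_dvd_pow_sub_one {n : ℕ} (hn : ¬ p - 1 ∣ n) :
    ∃ b : ℕ, ¬ p ∣ b ∧ ¬ (p : ℤ) ∣ (b : ℤ) ^ n - 1 := by
  obtain ⟨u, hu⟩ := IsCyclic.exists_generator (α := (ZMod p)ˣ)
  refine ⟨(u : ZMod p).val, ?_, ?_⟩
  · rw [← ZMod.natCast_eq_zero_iff, ZMod.natCast_zmod_val]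
    exact u.ne_zero
  · rw [← ZMod.intCast_zmod_eq_zero_iff_dvd]
    push_cast
    rw [ZMod.natCast_zmod_val, sub_eq_zero]
    intro h
    apply hn
    have h1 : u ^ n = 1 := Units.ext (by simpa using h)
    have h2 := orderOf_dvd_of_pow_eq_one h1
    rwa [orderOf_eq_card_of_forall_mem_zpowers hu, Nat.card_eq_fintype_card,
      ZMod.card_units_eq_totient, Nat.totient_prime hp.out] at h2

/-- **Kummer's congruence** for power sums. -/
theorem sq_dvd_kummer {n : ℕ} (hn : 2 ≤ n) (h : ¬ p - 1 ∣ n) :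
    (p : ℤ) ^ 2 ∣ n * unitPowSum p (n + (p - 1)) - (n - 1) * unitPowSum p n := by
  obtain ⟨b, hb, hbn⟩ := exists_not_dvd_pow_sub_one h
  obtain ⟨x, hx⟩ := sq_dvd_voronoi hb n
  obtain ⟨y, hy⟩ := sq_dvd_voronoi hb (n + (p - 1))
  obtain ⟨c, hc⟩ := dvd_unitPowSum (p := p) (n := n + (p - 1)) (by rwa [Nat.dvd_add_self_right])
  set F : ℤ := ∑ a ∈ Icc 1 (p - 1), ((a * b / p : ℕ) : ℤ) * ((a * b % p : ℕ) : ℤ) ^ (n - 1)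
  set G : ℤ := ∑ a ∈ Icc 1 (p - 1),
    ((a * b / p : ℕ) : ℤ) * ((a * b % p : ℕ) : ℤ) ^ (n + (p - 1) - 1)
  have hGF : (p : ℤ) ∣ G - F := by
    -- The exponents in F and G differ by p - 1, so Fermat's little theorem applies termwise.
    rw [← ZMod.intCast_zmod_eq_zero_iff_dvd, Int.cast_sub, sub_eq_zero]
    simp only [F, G, Int.cast_sum, Int.cast_mul, Int.cast_pow, Int.cast_natCast]
    refine sum_congr rfl fun a ha ↦ ?_
    rw [show n + (p - 1) - 1 = n - 1 + (p - 1) by omega, pow_add, ZMod.natCast_mod,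
      ZMod.pow_card_sub_one_eq_one, mul_one]
    push_cast
    refine mul_ne_zero (natCast_ne_zero_of_mem_Icc ha) ?_
    rwa [Ne, ZMod.natCast_eq_zero_iff]
  obtain ⟨d, hd⟩ := hGF
  have hbp : (p : ℤ) ∣ (b : ℤ) ^ (p - 1) - 1 := by
    rw [← ZMod.intCast_zmod_eq_zero_iff_dvd]
    push_cast
    rw [ZMod.pow_card_sub_one_eq_one (by rwa [Ne, ZMod.natCast_eq_zero_iff]), sub_self]
  obtain ⟨e, he⟩ := hbp
  have hcop : IsCoprime ((p : ℤ) ^ 2) ((b : ℤ) ^ n - 1) :=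
    ((Nat.prime_iff_prime_int.mp hp.out).coprime_iff_not_dvd.mpr hbn).pow_left
  refine hcop.dvd_of_dvd_mul_left (?_ : _ ∣ _ * _)
  have hcast : ((n + (p - 1) : ℕ) : ℤ) = n + p - 1 := by
    have := hp.out.two_le
    push_cast [show 1 ≤ p by omega]
    ring
  rw [hcast] at hy
  -- The witness is read off from n times Voronoi at n + p - 1 minus n - 1 times Voronoi at n: the F
  -- and G terms then cancel modulo p^2.
  refine ⟨n * y - (n - 1) * x - n * b ^ n * e * c + n * G + n * (n - 1) * d, ?_⟩
  rw [pow_add] at hy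
  have he' : (b : ℤ) ^ (p - 1) = 1 + p * e := by linarith
  rw [he'] at hy
  rw [hc] at hy ⊢
  have hG : G = F + p * d := by linarith
  rw [hG] at hy ⊢
  linear_combination n * hy - (n - 1) * hx

/-! ### Moments of the Fermat quotients modulo p -/

theorem dvd_fermatMoment_of_odd (h2 : p ≠ 2) {n : ℕ} (hn : Odd n) (h : ¬ p - 1 ∣ n - 1) :
    (p : ℤ) ∣ fermatMoment p n := by
  have hp0 : (p : ℤ) ≠ 0 := by exact_mod_cast hp.out.ne_zero
  have hp2 := hp.out.two_le
  refine Int.dvd_of_mul_dvd_mul_left hp0 ?_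
  rw [mul_fermatMoment, ← sq]
  have heven : Even (p - 1) := hp.out.even_sub_one h2
  have hn1 := hn.pos
  refine dvd_sub (sq_dvd_unitPowSum_of_odd h2 (hn.add_even heven) ?_)
    (sq_dvd_unitPowSum_of_odd h2 hn h)
  rwa [show n + (p - 1) - 1 = n - 1 + (p - 1) by omega, Nat.dvd_add_self_right]

theorem sq_dvd_mul_fermatMoment_add {n : ℕ} (hn : 2 ≤ n) (h : ¬ p - 1 ∣ n) :
    (p : ℤ) ^ 2 ∣ n * (p * fermatMoment p n) + unitPowSum p n := by
  rw [mul_fermatMoment]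
  convert sq_dvd_kummer hn h using 1
  ring

/-- Parseval's identity for the Fermat quotients modulo `p`. -/
theorem sum_intFermatQuot_sq_zmod :
    ((∑ a ∈ Icc 1 (p - 1), intFermatQuot p a ^ 2 : ℤ) : ZMod p) =
      -∑ i ∈ range (p - 1), (fermatMoment p i : ZMod p) * fermatMoment p (p - 1 - i) := by
  have hp2 := hp.out.two_le
  -- Off the diagonal this is a geometric sum: multiplied by a - b it yields b (a^(p-1) - b^(p-1)) =
  -- 0.
  have horth : ∀ a ∈ Icc 1 (p - 1), ∀ b ∈ Icc 1 (p - 1),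
      ∑ i ∈ range (p - 1), (a : ZMod p) ^ i * (b : ZMod p) ^ (p - 1 - i) =
        if a = b then -1 else 0 := by
    intro a ha b hb
    have ha0 := natCast_ne_zero_of_mem_Icc ha
    have hb0 := natCast_ne_zero_of_mem_Icc hb
    split_ifs with hab
    · subst hab
      rw [sum_congr rfl (g := fun _ ↦ 1)]
      · simp [Nat.cast_sub hp.out.one_le]
      · intro i hi
        rw [mem_range] at hi
        rw [← pow_add, Nat.add_sub_cancel' hi.le, ZMod.pow_card_sub_one_eq_one ha0]
    · have hne : (a : ZMod p) - b ≠ 0 := by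
        rw [sub_ne_zero, Ne, ZMod.natCast_eq_natCast_iff]
        intro h
        rw [mem_Icc] at ha hb
        exact hab (Nat.ModEq.eq_of_lt_of_lt h (by omega) (by omega))
      have hgeom := geom_sum₂_mul (a : ZMod p) b (p - 1)
      rw [ZMod.pow_card_sub_one_eq_one ha0, ZMod.pow_card_sub_one_eq_one hb0, sub_self] at hgeom
      rw [sum_congr rfl (g := fun i ↦ (a : ZMod p) ^ i * (b : ZMod p) ^ (p - 1 - 1 - i) * b),
        ← sum_mul, (mul_eq_zero.mp hgeom).resolve_right hne, zero_mul]
      intro i hi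
      rw [mem_range] at hi
      rw [mul_assoc, ← pow_succ, show p - 1 - 1 - i + 1 = p - 1 - i by omega]
  have hexp : ∑ i ∈ range (p - 1), (fermatMoment p i : ZMod p) * fermatMoment p (p - 1 - i) =
      ∑ a ∈ Icc 1 (p - 1), ∑ b ∈ Icc 1 (p - 1),
        (intFermatQuot p a : ZMod p) * intFermatQuot p b * if a = b then -1 else 0 := by
    simp only [fermatMoment, Int.cast_sum, sum_mul_sum]
    rw [sum_comm]
    refine sum_congr rfl fun a ha ↦ ?_
    rw [sum_comm]
    refine sum_congr rfl fun b hb ↦ ?_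
    rw [← horth a ha b hb, mul_sum]
    refine sum_congr rfl fun i _ ↦ ?_
    push_cast
    ring
  rw [hexp, ← sum_neg_distrib]
  push_cast
  refine sum_congr rfl fun a ha ↦ ?_
  simp only [mul_ite, mul_zero, sum_ite_eq, ha, if_true]
  ring

/-- **Lerch's congruence** between the Wilson quotient and the Fermat quotients. -/
theorem dvd_fermatMoment_zero_sub {w : ℤ} (hw : (p : ℤ) * w = (p - 1).factorial + 1)
    (h2 : p ≠ 2) : (p : ℤ) ∣ fermatMoment p 0 - w := by
  have hp2 := hp.out.two_le
  have hp0 : (p : ℤ) ≠ 0 := by exact_mod_cast hp.out.ne_zero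
  have hprod : ∀ s : Finset ℕ, (p : ℤ) ^ 2 ∣ ∏ a ∈ s, (1 + p * intFermatQuot p a) -
      (1 + p * ∑ a ∈ s, intFermatQuot p a) := by
    intro s
    induction s using Finset.induction_on with
    | empty => simp
    | insert a s has ih =>
      obtain ⟨c, hc⟩ := ih
      rw [prod_insert has, sum_insert has, sub_eq_iff_eq_add.mp hc]
      exact ⟨intFermatQuot p a * (∑ a ∈ s, intFermatQuot p a) +
        c * (1 + p * intFermatQuot p a), by ring⟩
  have hIco : Ico 1 p = Icc 1 (p - 1) := by ext; simp; omega
  -- The product of all a^(p-1) is (p-1)!^(p-1) = (pw - 1)^(p-1), which is 1 + pw modulo p^2 because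
  -- p - 1 is even.
  have hfac : ∏ a ∈ Icc 1 (p - 1), (1 + p * intFermatQuot p a) = (p * w - 1) ^ (p - 1) := by
    rw [hw, add_sub_cancel_right, ← Finset.prod_Ico_id_eq_factorial, Nat.sub_add_cancel hp.out.one_le, hIco, Nat.cast_prod, ← prod_pow]
    exact prod_congr rfl fun a ha ↦ (intFermatQuot_spec ha).symm
  obtain ⟨c, hc⟩ := hprod (Icc 1 (p - 1))
  obtain ⟨k, hk⟩ := Polynomial.powAddExpansion (-1 : ℤ) (p * w) (p - 1)
  have heven : Even (p - 1) := hp.out.even_sub_one h2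
  have hodd : Odd (p - 1 - 1) := Nat.Even.sub_odd (by omega) heven odd_one
  rw [hfac, sub_eq_neg_add (_ * w), hk, heven.neg_pow, hodd.neg_pow, one_pow, one_pow,
    Nat.cast_sub hp.out.one_le] at hc
  refine Int.dvd_of_mul_dvd_mul_left hp0 ⟨k * w ^ 2 - c - w, ?_⟩
  simp only [fermatMoment, pow_zero, mul_one]
  push_cast at hc
  linear_combination -hc

end Integers

/-! ### Divisibility by powers of p among rationals -/

/-- `x` is `p ^ k` times a `p`-adic integer. -/
def PadicDvd (p : ℕ) [Fact p.Prime] (k : ℕ) (x : ℚ) : Prop :=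
  ∃ y : ℤ_[p], (x : ℚ_[p]) = (p : ℚ_[p]) ^ k * y

namespace PadicDvd

variable {p : ℕ} [hp : Fact p.Prime] {k l : ℕ} {x y : ℚ}

theorem add (hx : PadicDvd p k x) (hy : PadicDvd p k y) : PadicDvd p k (x + y) := by
  obtain ⟨a, ha⟩ := hx
  obtain ⟨b, hb⟩ := hy
  exact ⟨a + b, by push_cast; rw [ha, hb]; ring⟩

theorem neg (hx : PadicDvd p k x) : PadicDvd p k (-x) := by
  obtain ⟨a, ha⟩ := hx
  exact ⟨-a, by push_cast; rw [ha]; ring⟩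

theorem sub (hx : PadicDvd p k x) (hy : PadicDvd p k y) : PadicDvd p k (x - y) := by
  rw [sub_eq_add_neg]
  exact hx.add hy.neg

theorem mul (hx : PadicDvd p k x) (hy : PadicDvd p l y) : PadicDvd p (k + l) (x * y) := by
  obtain ⟨a, ha⟩ := hx
  obtain ⟨b, hb⟩ := hy
  exact ⟨a * b, by push_cast; rw [ha, hb]; ring⟩

theorem mono (h : l ≤ k) (hx : PadicDvd p k x) : PadicDvd p l x := by
  obtain ⟨a, ha⟩ := hx
  refine ⟨p ^ (k - l) * a, ?_⟩
  push_cast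
  rw [ha, ← mul_assoc, ← pow_add, Nat.add_sub_cancel' h]

theorem of_dvd {a : ℤ} (h : (p : ℤ) ^ k ∣ a) : PadicDvd p k a := by
  obtain ⟨c, rfl⟩ := h
  exact ⟨c, by push_cast; rfl⟩

theorem intCast (a : ℤ) : PadicDvd p 0 a := of_dvd (by simp)

theorem natCast (a : ℕ) : PadicDvd p 0 a := by exact_mod_cast intCast (p := p) a

theorem pow_self (k : ℕ) : PadicDvd p k ((p : ℚ) ^ k) := ⟨1, by simp⟩

theorem sum {ι : Type*} (s : Finset ι) (f : ι → ℚ) (h : ∀ i ∈ s, PadicDvd p k (f i)) :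
    PadicDvd p k (∑ i ∈ s, f i) := by
  induction s using Finset.cons_induction with
  | empty => exact ⟨0, by simp⟩
  | cons a s has ih =>
    rw [sum_cons]
    exact (h a (mem_cons_self a s)).add (ih fun i hi ↦ h i (mem_cons_of_mem hi))

theorem inv_natCast {c : ℕ} (hc : ¬ p ∣ c) : PadicDvd p 0 (c : ℚ)⁻¹ := by
  have h : IsUnit (c : ℤ_[p]) := by
    rw [PadicInt.isUnit_iff, PadicInt.norm_natCast_eq_one_iff]
    exact (Nat.Prime.coprime_iff_not_dvd hp.out).mpr hc
  obtain ⟨b, hb⟩ := h.exists_right_inv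
  refine ⟨b, ?_⟩
  have hb' : (c : ℚ_[p]) * b = 1 := by exact_mod_cast congrArg ((↑) : ℤ_[p] → ℚ_[p]) hb
  push_cast
  rw [pow_zero, one_mul]
  exact (eq_inv_of_mul_eq_one_right hb').symm

/-- `p ^ m / c` is `p ^ k`-divisible as soon as `c < p ^ (m - k + 1)`. -/
theorem pow_div_natCast {m c : ℕ} (hkm : k ≤ m) (hc0 : c ≠ 0) (hc : c < p ^ (m - k + 1)) :
    PadicDvd p k ((p : ℚ) ^ m / c) := by
  obtain ⟨e, d, hd, rfl⟩ := Nat.exists_eq_pow_mul_and_not_dvd hc0 p hp.out.ne_one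
  have hp0 : (p : ℚ) ≠ 0 := by exact_mod_cast hp.out.ne_zero
  have hd0 : d ≠ 0 := by rintro rfl; simp at hd
  have he : e < m - k + 1 := by
    rw [← Nat.pow_lt_pow_iff_right hp.out.one_lt]
    exact lt_of_le_of_lt (Nat.le_mul_of_pos_right _ (Nat.pos_of_ne_zero hd0)) hc
  have hexp : (p : ℚ) ^ m / ((p ^ e * d : ℕ) : ℚ) = p ^ (m - e) * (d : ℚ)⁻¹ := by
    have hd0' : (d : ℚ) ≠ 0 := by exact_mod_cast hd0
    have : (p : ℚ) ^ m = p ^ (m - e) * p ^ e := by rw [← pow_add]; congr 1; omega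
    rw [this]
    push_cast
    field_simp
  rw [hexp]
  exact ((pow_self (m - e)).mul (inv_natCast hd)).mono (by omega)

end PadicDvd

/-! ### Bernoulli numbers and power sums p-adically -/

section Bernoulli

variable {p : ℕ} [hp : Fact p.Prime]

/-- By von Staudt–Clausen only the term 1/p can spoil integrality. The factor c serves the cases c =
1 and c = p together. -/
theorem PadicDvd.bernoulli_of_even {k : ℕ} {c : ℚ}
    (hc : PadicDvd p 0 c) (h : p - 1 ∣ 2 * k → PadicDvd p 0 (c / p)) :
    PadicDvd p 0 (c * bernoulli (2 * k)) := by
  obtain ⟨a, ha⟩ := Bernoulli.vonStaudt_clausen k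
  rw [← sub_eq_iff_eq_add] at ha
  rw [← ha, mul_sub, mul_sum]
  refine (hc.mul (.intCast a)).sub (.sum _ _ fun q hq ↦ ?_)
  rw [mem_filter] at hq
  by_cases hqp : q = p
  · subst hqp
    rw [mul_one_div]
    exact h hq.2.2
  · rw [one_div]
    exact hc.mul (.inv_natCast fun h ↦ hqp ((Nat.prime_dvd_prime_iff_eq hp.out hq.2.1).mp h).symm)

theorem PadicDvd.bernoulli_one_integral (h2 : p ≠ 2) : PadicDvd p 0 (bernoulli 1) := by
  rw [bernoulli_one, neg_div, one_div]
  exact_mod_cast (PadicDvd.inv_natCast (p := p) (c := 2) fun h ↦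
    h2 ((Nat.prime_dvd_prime_iff_eq hp.out Nat.prime_two).mp h)).neg

theorem PadicDvd.bernoulli_integral (h2 : p ≠ 2) {n : ℕ} (hn : p - 1 ∣ n → n = 0) :
    PadicDvd p 0 (bernoulli n) := by
  rcases Nat.even_or_odd' n with ⟨k, rfl | rfl⟩
  · rcases Nat.eq_zero_or_pos k with rfl | hk
    · simpa using PadicDvd.intCast (p := p) 1
    · rw [← one_mul (bernoulli _)]
      refine PadicDvd.bernoulli_of_even (by simpa using PadicDvd.intCast (p := p) 1) fun h ↦ ?_
      have := hn h
      omega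
  · rcases Nat.eq_zero_or_pos k with rfl | hk
    · exact PadicDvd.bernoulli_one_integral h2
    · rw [bernoulli_eq_zero_of_odd (by simp) (by omega)]
      simpa using PadicDvd.intCast (p := p) 0

theorem PadicDvd.mul_bernoulli (h2 : p ≠ 2) (n : ℕ) : PadicDvd p 0 (p * bernoulli n) := by
  rcases Nat.even_or_odd' n with ⟨k, rfl | rfl⟩
  · refine PadicDvd.bernoulli_of_even (.natCast p) fun _ ↦ ?_
    rw [div_self (by exact_mod_cast hp.out.ne_zero)]
    simpa using PadicDvd.intCast (p := p) 1
  · rcases Nat.eq_zero_or_pos k with rfl | hk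
    · exact (PadicDvd.natCast p).mul (PadicDvd.bernoulli_one_integral h2)
    · rw [bernoulli_eq_zero_of_odd (by simp) (by omega)]
      simpa using PadicDvd.intCast (p := p) 0

theorem unitPowSum_eq_sum_range {n : ℕ} (hn : n ≠ 0) :
    (unitPowSum p n : ℚ) = ∑ a ∈ range p, (a : ℚ) ^ n := by
  have hp2 := hp.out.two_le
  rw [range_eq_Ico, sum_eq_sum_Ico_succ_bot hp.out.pos, unitPowSum]
  have : Ico (0 + 1) p = Icc 1 (p - 1) := by ext; simp; omega
  rw [this]
  simp [hn]

theorem PadicDvd.faulhaber (h5 : 5 ≤ p) (m : ℕ) :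
    PadicDvd p 3 (unitPowSum p (m + 2) - (p * bernoulli (m + 2) +
      (m + 2) / 2 * p ^ 2 * bernoulli (m + 1) +
      (m + 2) * (m + 1) / 6 * p ^ 3 * bernoulli m)) := by
  have hm : ((m : ℚ) + 3) ≠ 0 := by positivity
  have e1 : ((m + 2 + 1).choose (m + 2) : ℚ) = m + 3 := by
    rw [Nat.choose_succ_self_right]; push_cast; ring
  have e2 : ((m + 2 + 1).choose (m + 1) : ℚ) = (m + 3) * (m + 2) / 2 := by
    rw [Nat.choose_symm_of_eq_add (show m + 2 + 1 = m + 1 + 2 by ring), Nat.cast_choose_two]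
    push_cast; ring
  have e3 : ((m + 2 + 1).choose m : ℚ) = (m + 3) * (m + 2) * (m + 1) / 6 := by
    have h := Nat.choose_succ_right_eq (m + 2 + 1) m
    rw [show m + 2 + 1 - m = 3 by omega] at h
    have h' : ((m + 2 + 1).choose (m + 1) : ℚ) * (m + 1) = (m + 2 + 1).choose m * 3 := by
      exact_mod_cast h
    rw [e2] at h'
    linarith
  rw [unitPowSum_eq_sum_range (by omega), sum_range_pow, sum_range_succ, sum_range_succ,
    sum_range_succ, e1, e2, e3, show m + 2 + 1 - (m + 2) = 1 by omega,
    show m + 2 + 1 - (m + 1) = 2 by omega, show m + 2 + 1 - m = 3 by omega]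
  push_cast
  have hcancel : ∀ T : ℚ, T + bernoulli m * ((m + 3) * (m + 2) * (m + 1) / 6) * p ^ 3 /
        (m + 2 + 1) + bernoulli (m + 1) * ((m + 3) * (m + 2) / 2) * p ^ 2 / (m + 2 + 1) +
        bernoulli (m + 2) * (m + 3) * p ^ 1 / (m + 2 + 1) -
      (p * bernoulli (m + 2) + (m + 2) / 2 * p ^ 2 * bernoulli (m + 1) +
      (m + 2) * (m + 1) / 6 * p ^ 3 * bernoulli m) = T := by
    intro T
    rw [show (m : ℚ) + 2 + 1 = m + 3 by ring]
    field_simp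
    ring
  rw [hcancel]
  refine .sum _ _ fun i hi ↦ ?_
  rw [mem_range] at hi
  obtain ⟨k, rfl⟩ := Nat.exists_eq_add_of_lt hi
  -- This trades the denominator m + 3 for k + 4 = m + 3 - i, which is small compared with the power
  -- of p present.
  have hchoose : ((i + k + 1 + 2 + 1).choose i : ℚ) / ((i + k + 1 : ℕ) + 2 + 1) =
      (i + k + 1 + 2).choose i / ((k + 4 : ℕ) : ℚ) := by
    have h := Nat.choose_mul_succ_eq (i + k + 1 + 2) i
    rw [show i + k + 1 + 2 + 1 - i = k + 4 by omega] at h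
    rw [div_eq_div_iff (by positivity) (by positivity)]
    have h' : ((i + k + 1 + 2).choose i : ℚ) * ((i + k + 1 + 2 + 1 : ℕ) : ℚ) =
      (i + k + 1 + 2 + 1).choose i * ((k + 4 : ℕ) : ℚ) := by exact_mod_cast h
    rw [← h']
    push_cast
    ring
  have hterm : bernoulli i * ((i + k + 1 + 2 + 1).choose i) *
      (p : ℚ) ^ (i + k + 1 + 2 + 1 - i) / ((i + k + 1 : ℕ) + 2 + 1) =
      (p * bernoulli i) * ((i + k + 1 + 2).choose i : ℕ) *
        ((p : ℚ) ^ (k + 3) / (k + 4 : ℕ)) := by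
    rw [mul_right_comm, mul_div_assoc, hchoose, show i + k + 1 + 2 + 1 - i = k + 3 + 1 by omega]
    ring
  rw [hterm]
  -- Here p ≥ 5 is essential: k = 0 requires 4 < p.
  have hlt : k + 4 < p ^ (k + 3 - 3 + 1) := by
    rw [Nat.add_sub_cancel]
    have h1 : k + 4 < 5 ^ (k + 1) := by
      clear * -
      induction k with
      | zero => norm_num
      | succ k ih => rw [pow_succ]; omega
    exact h1.trans_le (Nat.pow_le_pow_left h5 _)
  have := ((PadicDvd.mul_bernoulli (show p ≠ 2 by omega) i).mul
    (.natCast ((i + k + 1 + 2).choose i))).mul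
    (PadicDvd.pow_div_natCast (k := 3) (by omega) (by omega) hlt)
  simpa using this

/-- The p^2 term of Faulhaber's formula vanishes since n - 1 ≥ 3 is odd; the p^3 term is absorbed
since B_{n-2} is p-integral. -/
theorem PadicDvd.unitPowSum_sub_cube (h5 : 5 ≤ p) {n : ℕ} (hn : Even n) (h4 : 4 ≤ n)
    (h : ¬ p - 1 ∣ n - 2) : PadicDvd p 3 (unitPowSum p n - p * bernoulli n) := by
  obtain ⟨m, rfl⟩ := Nat.exists_eq_add_of_le' (show 2 ≤ n by omega)
  have h0 : bernoulli (m + 1) = 0 :=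
    bernoulli_eq_zero_of_odd (by grind) (by omega)
  have h6 : ¬ p ∣ 6 := fun h ↦ by
    rcases (hp.out.dvd_mul (m := 2) (n := 3)).mp h with h | h <;>
    · have := Nat.le_of_dvd (by norm_num) h
      omega
  have h1 : PadicDvd p 3 ((p : ℚ) ^ 3 * (((m + 2) * (m + 1) : ℕ) * ((6 : ℕ) : ℚ)⁻¹ *
      bernoulli m)) :=
    (PadicDvd.pow_self 3).mul (((PadicDvd.natCast _).mul (.inv_natCast h6)).mul
      (PadicDvd.bernoulli_integral (by omega) fun h' ↦ absurd h' h))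
  convert (PadicDvd.faulhaber h5 m).add h1 using 1
  rw [h0]
  push_cast
  ring

/-- Precision p^2 suffices for Kummer's congruence and also admits n = 2, where B_1 ≠ 0. -/
theorem PadicDvd.unitPowSum_sub_sq (h5 : 5 ≤ p) {n : ℕ} (hn : Even n) (h2 : 2 ≤ n)
    (h : n ≤ p - 2) : PadicDvd p 2 (unitPowSum p n - p * bernoulli n) := by
  have hndvd : ∀ k, k ≤ p - 2 → p - 1 ∣ k → k = 0 := fun k hk hd ↦
    Nat.eq_zero_of_dvd_of_lt hd (by omega)
  obtain ⟨m, rfl⟩ := Nat.exists_eq_add_of_le' h2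
  have hp2 : ¬ p ∣ 2 := fun h ↦ by
    have := Nat.le_of_dvd (by norm_num) h
    omega
  have h6 : ¬ p ∣ 6 := fun h ↦ by
    rcases (hp.out.dvd_mul (m := 2) (n := 3)).mp h with h | h <;>
    · have := Nat.le_of_dvd (by norm_num) h
      omega
  have h1 : PadicDvd p 3 ((p : ℚ) ^ 3 * (((m + 2) * (m + 1) : ℕ) * ((6 : ℕ) : ℚ)⁻¹ *
      bernoulli m)) :=
    (PadicDvd.pow_self 3).mul (((PadicDvd.natCast _).mul (.inv_natCast h6)).mul
      (PadicDvd.bernoulli_integral (by omega) (hndvd _ (by omega))))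
  have h3 : PadicDvd p 2 ((p : ℚ) ^ 2 * ((m + 2 : ℕ) * ((2 : ℕ) : ℚ)⁻¹ *
      bernoulli (m + 1))) :=
    (PadicDvd.pow_self 2).mul (((PadicDvd.natCast _).mul (.inv_natCast hp2)).mul
      (PadicDvd.bernoulli_integral (by omega) (hndvd _ (by omega))))
  convert (((PadicDvd.faulhaber h5 m).add h1).mono (by norm_num : 2 ≤ 3)).add h3 using 1
  push_cast
  ring

end Bernoulli

/-! ### Residues modulo p and Hensel digits -/

section Reduction

variable {p : ℕ} [hp : Fact p.Prime]

theorem PadicDvd.div_pow {k l : ℕ} {x : ℚ} (hx : PadicDvd p (k + l) x) :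
    PadicDvd p k (x / (p : ℚ) ^ l) := by
  obtain ⟨y, hy⟩ := hx
  have hp0 : (p : ℚ_[p]) ≠ 0 := by exact_mod_cast hp.out.ne_zero
  refine ⟨y, ?_⟩
  push_cast
  rw [hy, pow_add]
  field_simp

/-- The rational number `x` is a `p`-adic integer with residue `z` modulo `p`. -/
def Reduces (p : ℕ) [Fact p.Prime] (x : ℚ) (z : ZMod p) : Prop :=
  ∃ y : ℤ_[p], (y : ℚ_[p]) = (x : ℚ_[p]) ∧ PadicInt.toZMod y = z

namespace Reduces

variable {x y : ℚ} {u v : ZMod p}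

theorem add (hx : Reduces p x u) (hy : Reduces p y v) : Reduces p (x + y) (u + v) := by
  obtain ⟨a, ha, rfl⟩ := hx
  obtain ⟨b, hb, rfl⟩ := hy
  exact ⟨a + b, by push_cast; rw [ha, hb], map_add _ _ _⟩

theorem neg (hx : Reduces p x u) : Reduces p (-x) (-u) := by
  obtain ⟨a, ha, rfl⟩ := hx
  exact ⟨-a, by push_cast; rw [ha], map_neg _ _⟩

theorem sub (hx : Reduces p x u) (hy : Reduces p y v) : Reduces p (x - y) (u - v) := by
  rw [sub_eq_add_neg, sub_eq_add_neg]
  exact hx.add hy.neg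

theorem mul (hx : Reduces p x u) (hy : Reduces p y v) : Reduces p (x * y) (u * v) := by
  obtain ⟨a, ha, rfl⟩ := hx
  obtain ⟨b, hb, rfl⟩ := hy
  exact ⟨a * b, by push_cast; rw [ha, hb], map_mul _ _ _⟩

theorem intCast (a : ℤ) : Reduces p a a := ⟨a, by simp, by simp⟩

theorem natCast (a : ℕ) : Reduces p a a := ⟨a, by simp, by simp⟩

theorem pow (hx : Reduces p x u) (n : ℕ) : Reduces p (x ^ n) (u ^ n) := by
  obtain ⟨a, ha, rfl⟩ := hx
  exact ⟨a ^ n, by push_cast; rw [ha], map_pow _ _ _⟩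

theorem sum {ι : Type*} {s : Finset ι} {f : ι → ℚ} {g : ι → ZMod p}
    (h : ∀ i ∈ s, Reduces p (f i) (g i)) : Reduces p (∑ i ∈ s, f i) (∑ i ∈ s, g i) := by
  induction s using Finset.cons_induction with
  | empty => exact ⟨0, by simp⟩
  | cons a s has ih =>
    rw [sum_cons, sum_cons]
    exact (h a (mem_cons_self a s)).add (ih fun i hi ↦ h i (mem_cons_of_mem hi))

theorem of_padicDvd (hx : PadicDvd p 1 x) : Reduces p x 0 := by
  obtain ⟨a, ha⟩ := hx
  exact ⟨p * a, by rw [ha]; push_cast; ring, by simp⟩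

theorem inv_natCast {c : ℕ} (hc : ¬ p ∣ c) : Reduces p (c : ℚ)⁻¹ (c : ZMod p)⁻¹ := by
  obtain ⟨b, hb⟩ := PadicDvd.inv_natCast hc
  rw [pow_zero, one_mul] at hb
  refine ⟨b, hb.symm, eq_inv_of_mul_eq_one_right ?_⟩
  have hc0 : (c : ℚ_[p]) ≠ 0 := by
    rw [Nat.cast_ne_zero]
    rintro rfl
    simp at hc
  have h1 : (c : ℤ_[p]) * b = 1 := by
    apply PadicInt.ext
    push_cast at hb ⊢
    rw [← hb, mul_inv_cancel₀ hc0]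
  simpa using congrArg PadicInt.toZMod h1

theorem ratModEq (hx : Reduces p x u) (hy : Reduces p y u) : RatModEq p x y := by
  obtain ⟨a, ha, hau⟩ := hx
  obtain ⟨b, hb, hbu⟩ := hy
  rw [RatModEq, ← ha, ← hb]
  refine ⟨a.2, b.2, ?_⟩
  have h : a - b ∈ RingHom.ker (PadicInt.toZMod (p := p)) := by
    rw [RingHom.mem_ker, map_sub, hau, hbu, sub_self]
  rw [PadicInt.ker_toZMod, PadicInt.maximalIdeal_eq_span_p, Ideal.mem_span_singleton] at h
  obtain ⟨z, hz⟩ := h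
  exact ⟨z, by exact_mod_cast congrArg ((↑) : ℤ_[p] → ℚ_[p]) hz⟩

end Reduces

/-- The approximation N is p^n y modulo p^(n+1), so it is divisible by p^n with quotient congruent
to y modulo p. -/
theorem cast_henselDigit_pow_mul (y : ℤ_[p]) (n : ℕ) :
    (henselDigit ((p : ℤ_[p]) ^ n * y) n : ZMod p) = PadicInt.toZMod y := by
  have hp0 : (p : ℤ_[p]) ^ n ≠ 0 := pow_ne_zero _ (by exact_mod_cast hp.out.ne_zero)
  have h := PadicInt.appr_spec (n + 1) ((p : ℤ_[p]) ^ n * y)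
  rw [Ideal.mem_span_singleton] at h
  obtain ⟨z, hz⟩ := h
  rw [henselDigit]
  set N := ((p : ℤ_[p]) ^ n * y).appr (n + 1)
  have hN : (N : ℤ_[p]) = p ^ n * (y - p * z) := by
    rw [pow_succ] at hz
    linear_combination -hz
  have hdvd : p ^ n ∣ N := by
    have := (PadicInt.pow_p_dvd_int_iff (p := p) n N).mp ⟨_, by exact_mod_cast hN⟩
    exact_mod_cast this
  obtain ⟨d, hd⟩ := hdvd
  rw [hd, Nat.mul_div_cancel_left _ (pow_pos hp.out.pos n)]
  rw [hd] at hN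
  push_cast at hN
  have := congrArg PadicInt.toZMod (mul_left_cancel₀ hp0 hN)
  simpa using this

end Reduction

/-! ### Assembling the three congruences -/

section Quotients

variable {p : ℕ} [hp : Fact p.Prime]

theorem fermatQuot_eq_intCast {a : ℕ} (ha : a ∈ Icc 1 (p - 1)) :
    fermatQuot p a = intFermatQuot p a := by
  have hp0 : (p : ℚ) ≠ 0 := by exact_mod_cast hp.out.ne_zero
  have h : (a : ℚ) ^ (p - 1) = 1 + p * intFermatQuot p a := by
    exact_mod_cast intFermatQuot_spec ha
  rw [fermatQuot, h, add_sub_cancel_left, mul_div_cancel_left₀ _ hp0]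

theorem sum_fermatQuot_sq_eq_intCast :
    ∑ a ∈ Icc 1 (p - 1), fermatQuot p a ^ 2 =
      ((∑ a ∈ Icc 1 (p - 1), intFermatQuot p a ^ 2 : ℤ) : ℚ) := by
  push_cast
  exact sum_congr rfl fun a ha ↦ by rw [fermatQuot_eq_intCast ha]

theorem reduces_wilsonQuot (h2 : p ≠ 2) : Reduces p (wilsonQuot p) (fermatMoment p 0) := by
  have hp0 : (p : ℚ) ≠ 0 := by exact_mod_cast hp.out.ne_zero
  have hdvd : (p : ℤ) ∣ (p - 1).factorial + 1 := by
    rw [← ZMod.intCast_zmod_eq_zero_iff_dvd]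
    push_cast
    rw [ZMod.wilsons_lemma, neg_add_cancel]
  obtain ⟨w, hw⟩ := hdvd
  have hwq : wilsonQuot p = w := by
    rw [wilsonQuot, div_eq_iff hp0, mul_comm]
    exact_mod_cast hw
  have hz : (fermatMoment p 0 : ZMod p) = w := by
    rw [← sub_eq_zero, ← Int.cast_sub, ZMod.intCast_zmod_eq_zero_iff_dvd]
    exact dvd_fermatMoment_zero_sub hw.symm h2
  rw [hwq, hz]
  exact .intCast w

theorem fermatMoment_eq_zero_of_odd (h2 : p ≠ 2) {n : ℕ} (hn : Odd n) (h3 : 3 ≤ n)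
    (hnp : n ≤ p - 2) : (fermatMoment p n : ZMod p) = 0 := by
  rw [ZMod.intCast_zmod_eq_zero_iff_dvd]
  refine dvd_fermatMoment_of_odd h2 hn fun h ↦ ?_
  have := Nat.le_of_dvd (by omega) h
  omega

/-- For even n, n p M_n ≡ -S_n ≡ -p B_n (mod p^2), and np cancels; for odd n both sides vanish. -/
theorem reduces_divBernoulli (h5 : 5 ≤ p) {n : ℕ} (h2 : 2 ≤ n) (hn : n ≤ p - 2) :
    Reduces p (divBernoulli n) (-(fermatMoment p n : ZMod p)) := by
  rcases Nat.even_or_odd n with he | ho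
  · have hnp : ¬ p ∣ n := fun h ↦ by
      have := Nat.le_of_dvd (by omega) h
      omega
    have hnp' : ¬ p - 1 ∣ n := fun h ↦ by
      have := Nat.le_of_dvd (by omega) h
      omega
    have hp0 : (p : ℚ) ≠ 0 := by exact_mod_cast hp.out.ne_zero
    have hn0 : (n : ℚ) ≠ 0 := by
      rw [Nat.cast_ne_zero]
      omega
    have h1 := (PadicDvd.of_dvd (sq_dvd_mul_fermatMoment_add h2 hnp')).sub
      (PadicDvd.unitPowSum_sub_sq h5 he h2 hn)
    have h2 := (h1.div_pow (k := 1) (l := 1)).mul (PadicDvd.inv_natCast hnp)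
    have h3 : divBernoulli n = -((fermatMoment p n : ℤ) : ℚ) +
        (((n * (p * fermatMoment p n) + unitPowSum p n : ℤ) : ℚ) -
          (unitPowSum p n - p * bernoulli n)) / (p : ℚ) ^ 1 * (n : ℚ)⁻¹ := by
      rw [divBernoulli]
      push_cast
      field_simp
      ring
    rw [h3]
    simpa using (Reduces.intCast (p := p) (fermatMoment p n)).neg.add (.of_padicDvd h2)
  · have h3 : 3 ≤ n := by
      obtain ⟨k, rfl⟩ := ho
      omega
    rw [fermatMoment_eq_zero_of_odd (by omega) ho h3 hn, divBernoulli,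
      bernoulli_eq_zero_of_odd ho (by omega)]
    simpa using Reduces.intCast (p := p) 0

theorem fermatMoment_sub_one_zmod :
    (fermatMoment p (p - 1) : ZMod p) = fermatMoment p 0 := by
  rw [fermatMoment, fermatMoment]
  push_cast
  refine sum_congr rfl fun a ha ↦ ?_
  rw [ZMod.pow_card_sub_one_eq_one (natCast_ne_zero_of_mem_Icc ha), pow_zero]

theorem sum_intFermatQuot_sq_eq_sub_sum (h5 : 5 ≤ p) :
    ((∑ a ∈ Icc 1 (p - 1), intFermatQuot p a ^ 2 : ℤ) : ZMod p) =
      -(fermatMoment p 0 : ZMod p) ^ 2 -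
        ∑ i ∈ Icc 2 (p - 1 - 2), (-(fermatMoment p i : ZMod p)) *
          -(fermatMoment p (p - 1 - i) : ZMod p) := by
  rw [sum_intFermatQuot_sq_zmod,
    ← sum_subset (s₁ := insert 0 (Icc 2 (p - 1 - 2))) (s₂ := range (p - 1)),
    sum_insert (by simp), Nat.sub_zero, fermatMoment_sub_one_zmod]
  · simp only [neg_mul_neg]
    ring
  · intro i hi
    rw [mem_insert, mem_Icc] at hi
    rw [mem_range]
    omega
  · intro i hi hi'
    rw [mem_insert, mem_Icc] at hi'
    rw [mem_range] at hi
    have hodd : Odd (p - 2) := Nat.Odd.sub_even (by omega)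
      (hp.out.odd_of_ne_two (by omega)) even_two
    have hz := fermatMoment_eq_zero_of_odd (p := p) (by omega) hodd (by omega) le_rfl
    -- The two missing indices both carry the factor M_{p-2} ≡ 0; M_1 itself need not vanish.
    rcases (show i = 1 ∨ i = p - 2 by omega) with rfl | rfl
    · rw [show p - 1 - 1 = p - 2 by omega, hz, mul_zero]
    · rw [hz, zero_mul]

theorem padicDvd_unitPowSum_sub_one (h5 : 5 ≤ p) :
    PadicDvd p 3 (unitPowSum p (p - 1) - p * bernoulli (p - 1)) := by
  refine PadicDvd.unitPowSum_sub_cube h5 (hp.out.even_sub_one (by omega)) (by omega) fun h ↦ ?_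
  have := Nat.le_of_dvd (by omega) h
  omega

theorem padicDvd_unitPowSum_two_mul_sub_one (h5 : 5 ≤ p) :
    PadicDvd p 3 (unitPowSum p (2 * (p - 1)) - p * bernoulli (2 * (p - 1))) := by
  refine PadicDvd.unitPowSum_sub_cube h5 (even_two_mul _) (by omega) fun h ↦ ?_
  have h2 : p - 1 ∣ 2 := by
    have := Nat.dvd_sub (Dvd.intro_left 2 rfl) h
    rwa [Nat.sub_sub_self (by omega)] at this
  have := Nat.le_of_dvd (by omega) h2
  omega

theorem reduces_agohGiugaQuot_sub_one (h5 : 5 ≤ p) :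
    Reduces p (agohGiugaQuot p - 1) (fermatMoment p 0) := by
  have hp0 : (p : ℚ) ≠ 0 := by exact_mod_cast hp.out.ne_zero
  have h := ((padicDvd_unitPowSum_sub_one h5).div_pow (k := 2) (l := 1)).mono (by norm_num : 1 ≤ 2)
  have hS : (unitPowSum p (p - 1) : ℚ) = p - 1 + p * fermatMoment p 0 := by
    exact_mod_cast unitPowSum_sub_one (p := p)
  have heq : agohGiugaQuot p - 1 = ((fermatMoment p 0 : ℤ) : ℚ) -
      (unitPowSum p (p - 1) - p * bernoulli (p - 1)) / (p : ℚ) ^ 1 := by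
    rw [agohGiugaQuot, hS]
    field_simp
    ring
  rw [heq]
  simpa using (Reduces.intCast (p := p) (fermatMoment p 0)).sub (.of_padicDvd h)

theorem reduces_bernoulli_combination (h5 : 5 ≤ p) :
    Reduces p ((p * bernoulli (2 * (p - 1)) - 2 * p * bernoulli (p - 1) + p - 1) / p ^ 2)
      ((∑ a ∈ Icc 1 (p - 1), intFermatQuot p a ^ 2 : ℤ) : ZMod p) := by
  have hp0 : (p : ℚ) ≠ 0 := by exact_mod_cast hp.out.ne_zero
  have h := (((PadicDvd.intCast 2).mul (padicDvd_unitPowSum_sub_one h5)).sub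
    (by simpa using padicDvd_unitPowSum_two_mul_sub_one h5)).div_pow (k := 1) (l := 2)
  have hS : (p : ℚ) ^ 2 * ((∑ a ∈ Icc 1 (p - 1), intFermatQuot p a ^ 2 : ℤ) : ℚ) =
      unitPowSum p (2 * (p - 1)) - 2 * unitPowSum p (p - 1) + (p - 1) := by
    exact_mod_cast sq_mul_sum_intFermatQuot_sq (p := p)
  have heq : (p * bernoulli (2 * (p - 1)) - 2 * p * bernoulli (p - 1) + p - 1) / (p : ℚ) ^ 2 =
      ((∑ a ∈ Icc 1 (p - 1), intFermatQuot p a ^ 2 : ℤ) : ℚ) +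
      (((2 : ℤ) : ℚ) * (unitPowSum p (p - 1) - p * bernoulli (p - 1)) -
        (unitPowSum p (2 * (p - 1)) - p * bernoulli (2 * (p - 1)))) / (p : ℚ) ^ 2 := by
    rw [div_eq_iff (by positivity), add_mul, div_mul_cancel₀ _ (by positivity)]
    push_cast at hS ⊢
    linear_combination -hS
  rw [heq]
  convert (Reduces.intCast (p := p) (∑ a ∈ Icc 1 (p - 1), intFermatQuot p a ^ 2)).add
    (.of_padicDvd h) using 1
  rw [add_zero]

theorem reduces_divBernoulli_combination (h5 : 5 ≤ p) :
    Reduces p ((2 * p * divBernoulli (2 * (p - 1)) - p ^ 2 * divBernoulli (p - 1) ^ 2) / p ^ 2)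
      (-(fermatMoment p 0 : ZMod p) ^ 2 -
        ((∑ a ∈ Icc 1 (p - 1), intFermatQuot p a ^ 2 : ℤ) : ZMod p)) := by
  have hp0 : (p : ℚ) ≠ 0 := by exact_mod_cast hp.out.ne_zero
  have hpc : ((p - 1 : ℕ) : ℚ) = p - 1 := by
    rw [Nat.cast_sub hp.out.one_le, Nat.cast_one]
  have hp1 : (p : ℚ) - 1 ≠ 0 := by
    rw [← hpc, Nat.cast_ne_zero]
    omega
  have hndvd : ¬ p ∣ p - 1 := fun h ↦ by
    have := Nat.le_of_dvd (by omega) h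
    omega
  have hinv : Reduces p ((p : ℚ) - 1)⁻¹ (-1) := by
    have h := Reduces.inv_natCast hndvd
    rw [hpc] at h
    convert h using 1
    rw [Nat.cast_sub hp.out.one_le]
    simp
  have hS : (p : ℚ) ^ 2 * ((∑ a ∈ Icc 1 (p - 1), intFermatQuot p a ^ 2 : ℤ) : ℚ) =
      unitPowSum p (2 * (p - 1)) - 2 * unitPowSum p (p - 1) + (p - 1) := by
    exact_mod_cast sq_mul_sum_intFermatQuot_sq (p := p)
  have hS1 : (unitPowSum p (p - 1) : ℚ) = p - 1 + p * fermatMoment p 0 := by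
    exact_mod_cast unitPowSum_sub_one (p := p)
  have hu := padicDvd_unitPowSum_sub_one h5
  have hv := padicDvd_unitPowSum_two_mul_sub_one h5
  set s : ℤ := ∑ a ∈ Icc 1 (p - 1), intFermatQuot p a ^ 2
  set u : ℚ := unitPowSum p (p - 1) - p * bernoulli (p - 1) with hu_def
  set v : ℚ := unitPowSum p (2 * (p - 1)) - p * bernoulli (2 * (p - 1)) with hv_def
  have hβ : p * bernoulli (p - 1) = p - 1 + p * fermatMoment p 0 - u := by
    rw [hu_def, ← hS1]
    ring
  have hγ : p * bernoulli (2 * (p - 1)) =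
      p ^ 2 * (s : ℚ) + (p - 1) + 2 * p * fermatMoment p 0 - v := by
    rw [hv_def]
    linear_combination 2 * hS1 - hS
  have herr : PadicDvd p 3 ((2 * unitPowSum p (p - 1) : ℤ) * u - u * u - (p - 1 : ℤ) * v) := by
    have h1 := (PadicDvd.intCast (2 * unitPowSum p (p - 1))).mul hu
    have h2 := (hu.mul hu).mono (by norm_num : 3 ≤ 3 + 3)
    have h3 := (PadicDvd.intCast ((p : ℤ) - 1)).mul hv
    rw [zero_add] at h1 h3
    exact (h1.sub h2).sub h3
  -- With s = ∑ q_a^2, the numerator (p-1) p B_{2(p-1)} - (p B_{p-1})^2 loses its terms of order 1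
  -- and p, leaving p^2 ((p-1) s - M_0^2) plus an error divisible by p^3.
  have heq : (2 * p * divBernoulli (2 * (p - 1)) - p ^ 2 * divBernoulli (p - 1) ^ 2) / (p : ℚ) ^ 2 =
      (((p : ℕ) - 1 : ℤ) * (s : ℚ) - ((fermatMoment p 0 : ℤ) : ℚ) ^ 2 +
        ((2 * unitPowSum p (p - 1) : ℤ) * u - u * u - (p - 1 : ℤ) * v) / (p : ℚ) ^ 2) *
        ((p : ℚ) - 1)⁻¹ ^ 2 := by
    have e : 2 * p * divBernoulli (2 * (p - 1)) - (p : ℚ) ^ 2 * divBernoulli (p - 1) ^ 2 =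
        ((p - 1) * (p * bernoulli (2 * (p - 1))) - (p * bernoulli (p - 1)) ^ 2) *
          ((p : ℚ) - 1)⁻¹ ^ 2 := by
      rw [divBernoulli, divBernoulli, Nat.cast_mul, hpc]
      push_cast
      field_simp
    rw [e, hβ, hγ]
    push_cast
    rw [hS1]
    field_simp
    ring
  rw [heq]
  convert ((((Reduces.intCast (p := p) ((p : ℕ) - 1 : ℤ)).mul (.intCast s)).sub
    ((Reduces.intCast (p := p) (fermatMoment p 0)).pow 2)).add
      (.of_padicDvd (herr.div_pow (k := 1) (l := 2)))).mul (hinv.pow 2) using 1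
  push_cast
  simp
  ring

end Quotients

theorem theorem3 (p : ℕ) [Fact p.Prime] (hp : 5 ≤ p) :
    RatModEq p (∑ a ∈ Finset.Icc 1 (p - 1), fermatQuot p a ^ 2)
      (-wilsonQuot p ^ 2 - divBernoulliConv (p - 1)) ∧
    (∃ h : ‖((2 * p * divBernoulli (2 * (p - 1))
          - p ^ 2 * divBernoulli (p - 1) ^ 2 : ℚ) : ℚ_[p])‖ ≤ 1,
      RatModEq p (∑ a ∈ Finset.Icc 1 (p - 1), fermatQuot p a ^ 2)
        (-(agohGiugaQuot p - 1) ^ 2 - (henselDigit (⟨_, h⟩ : ℤ_[p]) 2 : ℚ))) ∧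
    RatModEq p (∑ a ∈ Finset.Icc 1 (p - 1), fermatQuot p a ^ 2)
      ((p * bernoulli (2 * (p - 1)) - 2 * p * bernoulli (p - 1) + p - 1) / p ^ 2) := by
  rw [sum_fermatQuot_sq_eq_intCast]
  have hL := Reduces.intCast (p := p) (∑ a ∈ Icc 1 (p - 1), intFermatQuot p a ^ 2)
  refine ⟨hL.ratModEq ?_, ?_, hL.ratModEq (reduces_bernoulli_combination hp)⟩
  · rw [sum_intFermatQuot_sq_eq_sub_sum hp]
    refine ((reduces_wilsonQuot (by omega)).pow 2).neg.sub (.sum fun i hi ↦ ?_)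
    rw [mem_Icc] at hi
    exact (reduces_divBernoulli hp (by omega) (by omega)).mul
      (reduces_divBernoulli hp (by omega) (by omega))
  -- The combination is p^2 y with y integral, so its digit at p^2 is the residue of y.
  · obtain ⟨y, hy, hyz⟩ := reduces_divBernoulli_combination hp
    have hp0 : (p : ℚ) ≠ 0 := by
      rw [Nat.cast_ne_zero]
      omega
    set X : ℚ := 2 * p * divBernoulli (2 * (p - 1)) - p ^ 2 * divBernoulli (p - 1) ^ 2
    have hX : ((p : ℤ_[p]) ^ 2 * y : ℤ_[p]) = (X : ℚ_[p]) := by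
      push_cast
      rw [hy]
      have : (p : ℚ) ^ 2 * (X / p ^ 2) = X := by field_simp
      exact_mod_cast this
    have hnorm : ‖(X : ℚ_[p])‖ ≤ 1 := hX ▸ PadicInt.norm_le_one _
    refine ⟨hnorm, hL.ratModEq ?_⟩
    have hmk : (⟨(X : ℚ_[p]), hnorm⟩ : ℤ_[p]) = (p : ℤ_[p]) ^ 2 * y := PadicInt.ext hX.symm
    have hdigit := cast_henselDigit_pow_mul y 2
    rw [hyz] at hdigit
    rw [hmk]
    convert ((reduces_agohGiugaQuot_sub_one hp).pow 2).neg.sub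
      (.natCast (henselDigit ((p : ℤ_[p]) ^ 2 * y) 2)) using 1
    rw [hdigit]
    ring
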